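/- **Setting.** Consider fermions with a finite set of modes, and a Hamiltonian $\hat H=\sum_{R\in\Lambda}\hat H_R$ ($\Lambda$ finite) on the corresponding Fock space. Every local term $\hat H_R$ is positive semidefinite and bosonic, i.e. it commutes with the fermion parity $(-1)^{\hat F}$, and $\hat H$ is frustration-free: there is a state $\Phi\neq0$ with $\hat H_R\Phi=0$ for all $R$. No translation invariance is assumed and the $\hat H_R$ need not be quadratic. The ground space is $\ker\hat H$, $\hat G$ is the orthogonal projector onto it, and the gap $\epsilon$ is the smallest positive eigenvalue of $\hat H$ (assumed to exist, i.e. $\hat H\ne0$). For a family $(\hat h_R)_{R\in\Lambda}$ of operators, the *interaction graph* has vertex set $\Lambda$, with $R$ and $R'$ adjacent when $[\hat h_R,\hat h_{R'}]\neq0$. Let $g$ be its maximum degree, $c$ its chromatic number, and $d$ its graph distance ($\infty$ if there is no path). For operators $\mathcal O,\mathcal O'$ on Fock space let $$D(\mathcal O,\mathcal O')=\min\{d(R,R') : [\hat h_R,\mathcal O]\neq0,\ [\hat h_{R'},\mathcal O']\neq0\},$$ with $\min\emptyset=\infty$. For a ground state $\Phi$ (a nonzero vector of $\ker\hat H$)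 put $$\mathcal C_\Phi(\mathcal O,\mathcal O')=\frac{|\langle\Phi|\mathcal O(1-\hat G)\mathcal O'|\Phi\rangle|}{\|\mathcal O^\dagger\Phi\|\,\|\mathcal O'\Phi\|},$$ read as $0$ if the denominator vanishes. The operators $\mathcal O,\mathcal O'$ are arbitrary; in particular they may be fermionic (parity-odd). **(1) Gosset–Huang inequality.** Suppose that all $\hat H_R$ are orthogonal projectors, and define $g,c,D$ by $\hat h_R=\hat H_R$. Then for every ground state $\Phi$ and all operators $\mathcal O,\mathcal O'$: if $D(\mathcal O,\mathcal O')<\infty$ and $c\ge2$, then $$\mathcal C_\Phi(\mathcal O,\mathcal O')\le 2e^2\exp\left(-\frac{D(\mathcal O,\mathcal O')-1}{c-1}\sqrt{\frac{\epsilon}{g^2+\epsilon}}\right),$$ and if $D(\mathcal O,\mathcal O')=\infty$, then $\mathcal C_\Phi(\mathcal O,\mathcal O')=0$. **(2) Finite-size gap bound.** Now let the $\hat H_R$ be general positive semidefinite terms as above, and define the interaction graph and $D$ by the orthogonal projectors $\hat h_R$ with $\ker\hat h_R=\ker\hat H_R$. Let $g_0\in\mathbb N$, $J\in\mathbb R$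 and $a,C,\Delta>0$. There are $C'>0$ and $L_0>1$, depending only on $g_0,J,a,C,\Delta$, with the following property. Let $L\ge L_0$ (the linear size) and consider any such system with maximum degree at most $g_0$ and $\|\hat H_R\|\le J$ for all $R$. If for some ground state $\Phi$ and some operators $\mathcal O,\mathcal O'$ $$aL\le D(\mathcal O,\mathcal O')<\infty\quad\text{and}\quad \mathcal C_\Phi(\mathcal O,\mathcal O')\ge C\,L^{-\Delta},$$ then $$\epsilon\le C'\,\frac{(\log L)^2}{L^2}.$$ **(3) Sequences of systems.** Consequently, let a sequence of such systems have linear sizes $L_n>1$ with $L_n\to\infty$, and let every member satisfy the hypotheses of (2) (except $L\ge L_0$) with the same $g_0,J,a,C,\Delta$. Then there is $C'>0$ with $\epsilon_n\le C'(\log L_n)^2/L_n^2$ for all $n$. -/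

import Mathlib

open Filter Topology

universe u v

noncomputable section

/-- Fermionic Fock space over a finite set `M` of modes: the finite-dimensional Hilbert space with
orthonormal occupation-number basis `|S⟩`, `S ⊆ M`. The order on `M` only fixes signs. -/
abbrev Fock (M : Type u) : Type u := EuclideanSpace ℂ (Finset M)

/-- The (bounded) linear operators on Fock space, of either or of no definite fermion parity. -/
abbrev FockOp (M : Type u) [Fintype M] : Type u := Fock M →L[ℂ] Fock M

/-- The annihilation operator `c_i`: `c_i |T⟩ = (-1)^{#{j ∈ T, j < i}} |T \ {i}⟩` if `i ∈ T`, and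
`c_i |T⟩ = 0` otherwise, written on amplitudes. -/
def annihilation {M : Type u} [Fintype M] [LinearOrder M] (i : M) : FockOp M :=
  LinearMap.toContinuousLinearMap
    { toFun := fun ψ => WithLp.toLp 2 fun S =>
        if i ∈ S then 0 else (-1 : ℂ) ^ (S.filter (· < i)).card * ψ (insert i S)
      map_add' := by
        intro ψ φ
        ext S
        by_cases h : i ∈ S <;> simp [h, mul_add]
      map_smul' := by
        intro a ψ
        ext S
        by_cases h : i ∈ S <;> simp [h, mul_left_comm] }

/-- The creation operator `c_i†`. -/
def creation {M : Type u} [Fintype M] [LinearOrder M] (i : M) : FockOp M :=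
  ContinuousLinearMap.adjoint (annihilation i)

/-- The fermion number operator `F = ∑ i, c_i† c_i`. -/
def fermionNumber (M : Type u) [Fintype M] [LinearOrder M] : FockOp M :=
  ∑ i : M, creation i * annihilation i

/-- The fermion parity `(-1)^F = exp (i π F)`. -/
def fermionParity (M : Type u) [Fintype M] [LinearOrder M] : FockOp M :=
  NormedSpace.exp (((Real.pi : ℂ) * Complex.I) • fermionNumber M)

/-- A frustration-free fermionic Hamiltonian, given by its decomposition into local terms indexed
by the finite set `Λ`. Energies are normalized so that every local term is positive semidefinite
with lowest eigenvalue `0`; the local terms are bosonic, i.e. they commute with the fermion parity;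
and some state is a ground state of all local terms simultaneously. -/
structure FrustrationFreeFermions (M : Type u) (Λ : Type v) [Fintype M] [LinearOrder M]
    [Fintype Λ] where
  /-- the local terms `H_R` -/
  term : Λ → FockOp M
  pos : ∀ R, (term R).IsPositive
  bosonic : ∀ R, Commute (term R) (fermionParity M)
  frustrationFree : ∃ Φ : Fock M, Φ ≠ 0 ∧ ∀ R, term R Φ = 0

/-! ### The interaction graph of a family of local terms -/

/-- The interaction graph: vertices are (the labels of) the local terms, and two of them are
adjacent when the local terms do not commute. -/
def interactionGraph {M : Type u} {Λ : Type v} [Fintype M] (H : Λ → FockOp M) :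
    SimpleGraph Λ where
  Adj R R' := ¬ Commute (H R) (H R')
  symm := ⟨fun _ _ h h' => h h'.symm⟩
  loopless := ⟨fun R h => h (Commute.refl (H R))⟩

open scoped Classical in
/-- The maximum degree `g` of the interaction graph. -/
def interactionDegree {M : Type u} {Λ : Type v} [Fintype M] [Fintype Λ] (H : Λ → FockOp M) : ℕ :=
  (interactionGraph H).maxDegree

/-- The distance `D(O, O')` between two operators: the smallest graph distance between a local term
that does not commute with `O` and a local term that does not commute with `O'`
(`⊤` if there is no path between such terms, in particular if there are no such terms). -/
def operatorDist {M : Type u} {Λ : Type v} [Fintype M] (H : Λ → FockOp M) (O O' : FockOp M) : ℕ∞ :=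
  ⨅ (R : Λ) (_ : ¬ Commute (H R) O) (R' : Λ) (_ : ¬ Commute (H R') O'),
    (interactionGraph H).edist R R'

namespace FrustrationFreeFermions

variable {M : Type u} {Λ : Type v} [Fintype M] [LinearOrder M] [Fintype Λ]

/-- The Hamiltonian `H = ∑ R, H_R`. -/
def hamiltonian (S : FrustrationFreeFermions M Λ) : FockOp M := ∑ R, S.term R

/-- The ground space: the eigenspace of `H` for its lowest eigenvalue `0`. -/
def groundSpace (S : FrustrationFreeFermions M Λ) : Submodule ℂ (Fock M) :=
  LinearMap.ker (S.hamiltonian : Fock M →ₗ[ℂ] Fock M)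

/-- The orthogonal projector `G` onto the ground space. -/
def groundProj (S : FrustrationFreeFermions M Λ) : FockOp M := S.groundSpace.starProjection

/-- `Φ` is a (not necessarily normalized) ground state. -/
def IsGroundState (S : FrustrationFreeFermions M Λ) (Φ : Fock M) : Prop :=
  Φ ≠ 0 ∧ Φ ∈ S.groundSpace

/-- `ε` is the finite-size gap: since the lowest eigenvalue of `H` is `0`, it is the smallest
positive eigenvalue of `H`. -/
def IsGap (S : FrustrationFreeFermions M Λ) (ε : ℝ) : Prop :=
  IsLeast {E : ℝ | 0 < E ∧
    Module.End.HasEigenvalue (S.hamiltonian : Module.End ℂ (Fock M)) (E : ℂ)} ε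

/-- The normalized correlation
`|⟨Φ| O (1 - G) O' |Φ⟩| / (‖O† Φ‖ ‖O' Φ‖)`.
(If the denominator vanishes, so does the numerator, and the value is `0`.) -/
def correlation (S : FrustrationFreeFermions M Λ) (Φ : Fock M) (O O' : FockOp M) : ℝ :=
  ‖inner ℂ Φ ((O * (1 - S.groundProj) * O') Φ)‖ /
    (‖ContinuousLinearMap.adjoint O Φ‖ * ‖O' Φ‖)

/-- The local term `H_R` deformed into an orthogonal projector with the same kernel. -/
def termProj (S : FrustrationFreeFermions M Λ) (R : Λ) : FockOp M :=
  (LinearMap.ker (S.term R : Fock M →ₗ[ℂ] Fock M))ᗮ.starProjection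

end FrustrationFreeFermions

end

/-! Let `K` be the ground space, `P R` projectors with common kernel `K`, and `T` the product of all
`1 - P R`, arranged in `c` layers, one per colour, of mutually commuting factors. `T` fixes `K`. By
the detectability lemma (`norm_sq_complProd_apply_le`) a gap `ε` forces `‖T x‖² ≤ (1 - δ) ‖x‖²` on
`Kᗮ`, with `δ = ε / (g² + ε)`. Hence `A = T† T` is `1` on `K` and has spectrum in `[0, 1 - δ]` on
`Kᗮ`.

Low powers of `A` are invisible to distant operators. In `⟨Φ| O Aᵏ O' |Φ⟩` every factor outside the
light cone of `O'` commutes through to `Φ` and disappears; if there are at most `D` layers, the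
surviving factors commute with `O` and are absorbed by `⟨Φ|`. Neighbouring equal layers merge, so
`Aᵏ` costs only `2 (c - 1) k + 1` layers. For a polynomial `p` with `p(1) = 1` and degree about `D /
(2 (c - 1))`, the operator `p(A)` may therefore be inserted next to `1 - G` for free. A rescaled
Chebyshev polynomial is of size `2 exp(-2 m √δ)` on `[0, 1 - δ]`, and this is the source of the
square root of the gap.

For general terms, `H_R ≤ J h_R` (`J > 0`) gives the projectors a gap of at least `ε / J`, and
greedy colouring bounds the number of layers. Comparing the exponential with `C L^(-Δ)` gives `√δ =
O(log L / L)`, which is the gap bound. -/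

noncomputable section

/-! ### A polynomial that is small on `[0, 1 - δ]` -/

/-- The logarithm of the right side is `2 artanh s`, whose power series starts with `2 s` and has
nonnegative terms. -/
theorem exp_two_mul_le_div {s : ℝ} (h0 : 0 ≤ s) (h1 : s < 1) :
    Real.exp (2 * s) ≤ (1 + s) / (1 - s) := by
  have hpos : 0 < (1 + s) / (1 - s) := div_pos (by linarith) (by linarith)
  have h := Real.sum_range_le_log_div h0 h1 1
  simp at h
  calc Real.exp (2 * s) ≤ Real.exp (Real.log ((1 + s) / (1 - s))) := Real.exp_le_exp.2 (by linarith)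
    _ = _ := Real.exp_log hpos

theorem exists_polynomial_le_exp {δ : ℝ} (h0 : 0 < δ) (h1 : δ < 1) (m : ℕ) :
    ∃ p : Polynomial ℝ, p.natDegree ≤ m ∧ p.eval 1 = 1 ∧
      ∀ x ∈ Set.Icc 0 (1 - δ), |p.eval x| ≤ 2 * Real.exp (-(2 * m * √δ)) := by
  set s := √δ with hs
  have hs0 : 0 < s := Real.sqrt_pos.2 h0
  have hss : s ^ 2 = δ := Real.sq_sqrt h0.le
  have hs1 : s < 1 := by nlinarith
  -- The affine map taking `[0, 1 - δ]` onto `[-1, 1]`. It sends `1` to `(1 + s²) / (1 - s²) = cosh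
  -- (log z)`, so the Chebyshev value there is `cosh (m log z) ≥ exp (2 m s) / 2`.
  set r : Polynomial ℝ := Polynomial.C (2 / (1 - δ)) * Polynomial.X - Polynomial.C 1 with hr
  have hre : ∀ x, r.eval x = 2 / (1 - δ) * x - 1 := by intro x; simp [hr]
  set z := (1 + s) / (1 - s) with hz
  have hz0 : 0 < z := div_pos (by linarith) (by linarith)
  have hr1 : r.eval 1 = Real.cosh (Real.log z) := by
    rw [hre, Real.cosh_eq, Real.exp_neg, Real.exp_log hz0, hz, ← hss]
    have : 1 - s ≠ 0 := by linarith
    have : 1 + s ≠ 0 := by linarith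
    have : 1 - s ^ 2 ≠ 0 := by nlinarith
    field_simp
    ring
  have hT1 : Real.exp (2 * m * s) / 2 ≤ (Polynomial.Chebyshev.T ℝ m).eval (r.eval 1) := by
    rw [hr1, Polynomial.Chebyshev.T_real_cosh, Real.cosh_eq]
    have : Real.exp (2 * m * s) ≤ Real.exp (((m : ℤ) : ℝ) * Real.log z) := by
      apply Real.exp_le_exp.2
      have := (Real.le_log_iff_exp_le hz0).2 (exp_two_mul_le_div hs0.le hs1)
      push_cast
      nlinarith [Nat.cast_nonneg (α := ℝ) m]
    have := Real.exp_pos (-(((m : ℤ) : ℝ) * Real.log z))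
    linarith
  set t := (Polynomial.Chebyshev.T ℝ m).eval (r.eval 1) with ht
  have ht0 : 0 < t := lt_of_lt_of_le (by positivity) hT1
  refine ⟨Polynomial.C t⁻¹ * (Polynomial.Chebyshev.T ℝ m).comp r, ?_, ?_, ?_⟩
  · refine (Polynomial.natDegree_C_mul_le _ _).trans (Polynomial.natDegree_comp_le.trans ?_)
    have h2 : r.natDegree ≤ 1 := by
      rw [hr]; compute_degree
    have h3 : (Polynomial.Chebyshev.T ℝ (m : ℤ)).natDegree = m := by
      simp [Polynomial.Chebyshev.natDegree_T]
    rw [h3]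
    nlinarith
  · simp [Polynomial.eval_comp, ← ht, ht0.ne']
  · rintro x ⟨hx0, hx1⟩
    rw [Polynomial.eval_mul, Polynomial.eval_C, Polynomial.eval_comp, abs_mul, abs_inv,
      abs_of_pos ht0]
    have hb : |(Polynomial.Chebyshev.T ℝ m).eval (r.eval x)| ≤ 1 := by
      apply Polynomial.Chebyshev.abs_eval_T_real_le_one
      have h1δ : 0 < 1 - δ := by linarith
      have : x / (1 - δ) ≤ 1 := (div_le_one h1δ).2 hx1
      have : 0 ≤ x / (1 - δ) := by positivity
      rw [hre, div_mul_eq_mul_div, mul_div_assoc, abs_le]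
      constructor <;> linarith
    rw [Real.exp_neg]
    have : t⁻¹ ≤ 2 * (Real.exp (2 * m * s))⁻¹ := by
      calc t⁻¹ ≤ (Real.exp (2 * m * s) / 2)⁻¹ := inv_anti₀ (by positivity) hT1
        _ = _ := by rw [inv_div, div_eq_mul_inv]
    calc _ ≤ t⁻¹ * 1 := by gcongr
      _ ≤ _ := by simpa using this

/-! ### Greedy colouring -/

open scoped Classical in
-- Vertices are coloured one at a time: the neighbours of a new vertex block fewer than `n` colours.
theorem SimpleGraph.colorable_of_degree_lt {V : Type*} [Fintype V] (G : SimpleGraph V) {n : ℕ}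
    (h : ∀ v, G.degree v < n) : G.Colorable n := by
  suffices H : ∀ s : Finset V, ∃ f : V → Fin n, ∀ v ∈ s, ∀ w ∈ s, G.Adj v w → f v ≠ f w by
    obtain ⟨f, hf⟩ := H Finset.univ
    exact ⟨SimpleGraph.Coloring.mk f fun {v w} hvw => hf v (by simp) w (by simp) hvw⟩
  intro s
  induction s using Finset.induction_on with
  | empty => exact ⟨fun v => ⟨0, (Nat.zero_le _).trans_lt (h v)⟩, by simp⟩
  | insert a s ha ih =>
    obtain ⟨f, hf⟩ := ih
    obtain ⟨k, hk⟩ : ∃ k : Fin n, k ∉ (G.neighborFinset a).image f := by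
      by_contra! hcon
      have h1 : Finset.univ ⊆ (G.neighborFinset a).image f := fun k _ => hcon k
      have h2 := (Finset.card_le_card h1).trans Finset.card_image_le
      rw [Finset.card_univ, Fintype.card_fin, SimpleGraph.card_neighborFinset_eq_degree] at h2
      exact absurd (h a) (by omega)
    have hk' : ∀ w, G.Adj a w → f w ≠ k := fun w hw he =>
      hk (Finset.mem_image.2 ⟨w, by simpa using hw, he⟩)
    refine ⟨Function.update f a k, ?_⟩
    intro v hv w hw hvw
    by_cases hva : v = a
    · subst hva
      have hne : w ≠ v := hvw.ne'
      simpa [Function.update_of_ne hne] using (hk' w hvw).symm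
    · by_cases hwa : w = a
      · subst hwa
        simpa [Function.update_of_ne hva] using hk' v hvw.symm
      · rw [Function.update_of_ne hva, Function.update_of_ne hwa]
        exact hf v (Finset.mem_of_mem_insert_of_ne hv hva) w
          (Finset.mem_of_mem_insert_of_ne hw hwa) hvw

/-! ### Products of complementary projectors -/

section Projections

variable {E : Type*} [NormedAddCommGroup E] [InnerProductSpace ℂ E] {Λ : Type*}

/-- The product of the complementary projectors `1 - P R` along a list. -/
def complProd (P : Λ → E →L[ℂ] E) (l : List Λ) : E →L[ℂ] E := (l.map fun R => 1 - P R).prod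

@[simp] theorem complProd_nil (P : Λ → E →L[ℂ] E) : complProd P [] = 1 := rfl

@[simp] theorem complProd_cons (P : Λ → E →L[ℂ] E) (R : Λ) (l : List Λ) :
    complProd P (R :: l) = (1 - P R) * complProd P l := by simp [complProd]

@[simp] theorem complProd_append (P : Λ → E →L[ℂ] E) (l l' : List Λ) :
    complProd P (l ++ l') = complProd P l * complProd P l' := by simp [complProd]

/-- The common kernel of a family of operators. -/
def commonKer (P : Λ → E →L[ℂ] E) : Submodule ℂ E := ⨅ R, LinearMap.ker (P R : E →ₗ[ℂ] E)

theorem mem_commonKer {P : Λ → E →L[ℂ] E} {x : E} : x ∈ commonKer P ↔ ∀ R, P R x = 0 := by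
  simp [commonKer]

variable {P : Λ → E →L[ℂ] E}

theorem complProd_apply_of_mem {x : E} (hx : x ∈ commonKer P) (l : List Λ) :
    complProd P l x = x := by
  induction l with
  | nil => simp
  | cons R l ih => simp [ih, mem_commonKer.1 hx R]

open scoped Classical in
/-- The norm of the component of the state that the factor `1 - P R` of `complProd P l` removes. -/
def removedNorm (P : Λ → E →L[ℂ] E) (x : E) : List Λ → Λ → ℝ
  | [] => 0
  | a :: l => Function.update (removedNorm P x l) a ‖P a (complProd P l x)‖

theorem removedNorm_of_notMem (x : E) {l : List Λ} {R : Λ} (hR : R ∉ l) :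
    removedNorm P x l R = 0 := by
  classical
  induction l with
  | nil => rfl
  | cons a l ih =>
    rw [List.mem_cons, not_or] at hR
    rw [removedNorm, Function.update_of_ne hR.1, ih hR.2]

/-! ### Light cones -/

theorem commute_complProd {A : E →L[ℂ] E} {l : List Λ} (h : ∀ R ∈ l, Commute (P R) A) :
    Commute (complProd P l) A := by
  induction l with
  | nil => exact Commute.one_left A
  | cons R l ih =>
    rw [complProd_cons]
    exact ((Commute.one_left A).sub_left (h R (by simp))).mul_left
      (ih fun R' hR' => h R' (by simp [hR']))

open scoped Classical in
-- For `R ∉ S`, the projector `P R` commutes with the other factors of the layer and with `B`, so it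
-- reaches `x` and annihilates it; the factor `1 - P R` then acts as the identity.
theorem complProd_apply_eq_filter {S : Set Λ} {l : List Λ}
    (hl : ∀ R ∈ l, ∀ R' ∈ l, Commute (P R) (P R')) {B : E →L[ℂ] E} {x : E} (hx : x ∈ commonKer P)
    (hB : ∀ R ∈ l, R ∉ S → Commute (P R) B) :
    complProd P l (B x) = complProd P (l.filter (· ∈ S)) (B x) := by
  induction l with
  | nil => simp
  | cons R l ih =>
    have ih := ih (fun R hR R' hR' => hl R (by simp [hR]) R' (by simp [hR']))
      (fun R' hR' => hB R' (by simp [hR']))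
    rw [complProd_cons]
    change (1 - P R) (complProd P l (B x)) = _
    rw [ih]
    by_cases hR : R ∈ S
    · simp [hR]
    · have hc : Commute (complProd P (l.filter (· ∈ S)) * B) (P R) :=
        (commute_complProd fun R' hR' => hl R' (by simp [(List.mem_filter.1 hR').1]) R
          (by simp)).mul_left (hB R (by simp) hR).symm
      have hz : P R (complProd P (l.filter (· ∈ S)) (B x)) = 0 := by
        have := congrArg (fun A : E →L[ℂ] E => A x) hc.eq
        simp only [mul_apply_eq_comp, mem_commonKer.1 hx R, map_zero] at this
        exact this.symm
      simp [hR, hz]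

/-- Layers that lie outside the light cone `S` of `B` act trivially. -/
theorem exists_complProd_flatten_apply_eq {S : ℕ → Set Λ} {B : E →L[ℂ] E}
    (hmono : Monotone S)
    (hS : ∀ n, ∀ R ∉ S (n + 1), ∀ R' ∈ S n, Commute (P R) (P R'))
    (hB : ∀ n, ∀ R ∉ S (n + 1), Commute (P R) B) {x : E} (hx : x ∈ commonKer P)
    (ls : List (List Λ)) (hls : ∀ l ∈ ls, ∀ R ∈ l, ∀ R' ∈ l, Commute (P R) (P R')) :
    ∃ w : List Λ, (∀ R ∈ w, R ∈ S ls.length) ∧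
      complProd P ls.flatten (B x) = complProd P w (B x) := by
  classical
  induction ls with
  | nil => exact ⟨[], by simp, by simp⟩
  | cons l ls ih =>
    obtain ⟨w, hw, he⟩ := ih fun l' hl' => hls l' (by simp [hl'])
    refine ⟨l.filter (· ∈ S (ls.length + 1)) ++ w, ?_, ?_⟩
    · intro R hR
      rcases List.mem_append.1 hR with h | h
      · simpa using (List.mem_filter.1 h).2
      · exact hmono (Nat.le_succ _) (hw R h)
    · rw [List.flatten_cons, complProd_append, complProd_append]
      change complProd P l (complProd P ls.flatten (B x)) = complProd P _ ((complProd P w * B) x)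
      rw [he]
      -- The operator grown so far, `complProd P w * B`, plays the role of `B` for the next layer.
      refine complProd_apply_eq_filter (B := complProd P w * B) (hls l (by simp)) hx ?_
      intro R _ hR
      exact (commute_complProd fun R' hR' => (hS _ R hR R' (hw R' hR')).symm).symm.mul_right
        (hB _ R hR)

theorem complProd_reverse (l : List Λ) (hl : ∀ R ∈ l, ∀ R' ∈ l, Commute (P R) (P R')) :
    complProd P l.reverse = complProd P l := by
  induction l with
  | nil => rfl
  | cons R l ih =>
    have ih := ih fun R hR R' hR' => hl R (by simp [hR]) R' (by simp [hR'])
    have hc : Commute (complProd P l) (1 - P R) :=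
      (Commute.one_right _).sub_right
        (commute_complProd fun R' hR' => hl R' (by simp [hR']) R (by simp))
    rw [List.reverse_cons, complProd_append, ih, complProd_cons, complProd_cons, complProd_nil,
      mul_one, hc.eq]

variable [CompleteSpace E]

theorem IsStarProjection.inner_apply {P : E →L[ℂ] E} (hP : IsStarProjection P) (x y : E) :
    inner ℂ (P x) y = inner ℂ x (P y) := by
  have h := ContinuousLinearMap.adjoint_inner_left P y x
  rwa [← ContinuousLinearMap.star_eq_adjoint, hP.isSelfAdjoint.star_eq] at h

theorem IsStarProjection.apply_apply {P : E →L[ℂ] E} (hP : IsStarProjection P) (x : E) :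
    P (P x) = P x := by
  have h := hP.isIdempotentElem.eq
  exact congrArg (fun A : E →L[ℂ] E => A x) h

theorem IsStarProjection.norm_sq_eq {P : E →L[ℂ] E} (hP : IsStarProjection P) (x : E) :
    ‖P x‖ ^ 2 = RCLike.re (inner ℂ x (P x)) := by
  rw [← hP.apply_apply x, ← hP.inner_apply, hP.apply_apply, inner_self_eq_norm_sq]

theorem IsStarProjection.norm_sq_add {P : E →L[ℂ] E} (hP : IsStarProjection P) (x : E) :
    ‖P x‖ ^ 2 + ‖(1 - P) x‖ ^ 2 = ‖x‖ ^ 2 := by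
  rw [hP.norm_sq_eq, hP.one_sub.norm_sq_eq, ← inner_self_eq_norm_sq (𝕜 := ℂ) x, ← map_add,
    ← inner_add_right]
  simp

theorem IsStarProjection.norm_apply_le {P : E →L[ℂ] E} (hP : IsStarProjection P) (x : E) :
    ‖P x‖ ≤ ‖x‖ :=
  (sq_le_sq₀ (norm_nonneg _) (norm_nonneg _)).1
    (by linarith [hP.norm_sq_add x, sq_nonneg ‖(1 - P) x‖])

theorem adjoint_complProd (hP : ∀ R, IsStarProjection (P R)) (l : List Λ) :
    star (complProd P l) = complProd P l.reverse := by
  induction l with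
  | nil => simp
  | cons R l ih => simp [ih, (hP R).isSelfAdjoint.star_eq]

theorem inner_complProd_left (hP : ∀ R, IsStarProjection (P R)) (l : List Λ) (x y : E) :
    inner ℂ (complProd P l x) y = inner ℂ x (complProd P l.reverse y) := by
  rw [← adjoint_complProd hP, ContinuousLinearMap.star_eq_adjoint,
    ContinuousLinearMap.adjoint_inner_right]

theorem complProd_apply_mem_orthogonal (hP : ∀ R, IsStarProjection (P R)) {x : E}
    (hx : x ∈ (commonKer P)ᗮ) (l : List Λ) : complProd P l x ∈ (commonKer P)ᗮ := by
  rw [Submodule.mem_orthogonal] at hx ⊢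
  intro y hy
  have h := inner_complProd_left hP l.reverse y x
  rw [List.reverse_reverse, complProd_apply_of_mem hy] at h
  rw [← h, hx y hy]

/-! ### The detectability lemma -/

/-- Pythagoras at each factor, telescoped. Without repetitions no recorded norm is overwritten. -/
theorem sum_removedNorm_sq [Fintype Λ] (hP : ∀ R, IsStarProjection (P R)) (x : E) {l : List Λ}
    (hl : l.Nodup) : ∑ R, removedNorm P x l R ^ 2 = ‖x‖ ^ 2 - ‖complProd P l x‖ ^ 2 := by
  classical
  induction l with
  | nil => simp [removedNorm]
  | cons a l ih =>
    rw [List.nodup_cons] at hl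
    have ih := ih hl.2
    rw [← Finset.add_sum_erase _ _ (Finset.mem_univ a)] at ih ⊢
    rw [removedNorm_of_notMem x hl.1] at ih
    have hs : ∑ R ∈ Finset.univ.erase a, removedNorm P x (a :: l) R ^ 2 =
        ∑ R ∈ Finset.univ.erase a, removedNorm P x l R ^ 2 :=
      Finset.sum_congr rfl fun R hR => by
        rw [removedNorm, Function.update_of_ne (Finset.ne_of_mem_erase hR)]
    rw [hs, removedNorm, Function.update_self, complProd_cons]
    have := (hP a).norm_sq_add (complProd P l x)
    change _ = _ - ‖(1 - P a) (complProd P l x)‖ ^ 2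
    linarith

open scoped Classical in
-- `P R` is pushed through the product from the left: it passes the factors it commutes with, each
-- neighbour `j` costs at most the norm removed by `j`, and the factor `1 - P R` kills what is left.
-- The `if` covers tails of the list that do not contain `R`.
theorem norm_apply_complProd_le [Fintype Λ] (hP : ∀ R, IsStarProjection (P R)) (G : SimpleGraph Λ)
    (hG : ∀ R R', ¬ G.Adj R R' → Commute (P R) (P R')) (x : E) {l : List Λ} (hl : l.Nodup)
    (R : Λ) :
    ‖P R (complProd P l x)‖ ≤ (if R ∈ l then 0 else ‖P R x‖) +
      ∑ j ∈ G.neighborFinset R, removedNorm P x l j := by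
  induction l with
  | nil => simp [removedNorm]
  | cons a l ih =>
    rw [List.nodup_cons] at hl
    have ih := ih hl.2
    have hnn : ∀ (l : List Λ) j, 0 ≤ removedNorm P x l j := by
      intro l j
      induction l with
      | nil => exact le_rfl
      | cons b l ih =>
        rw [removedNorm, Function.update_apply]
        split_ifs
        · exact norm_nonneg _
        · exact ih
    rw [complProd_cons]
    change ‖P R ((1 - P a) (complProd P l x))‖ ≤ _
    by_cases haR : R = a
    · subst haR
      have h0 : P R ((1 - P R) (complProd P l x)) = 0 := by
        simp [(hP R).apply_apply]
      rw [h0, norm_zero]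
      exact add_nonneg (by simp) (Finset.sum_nonneg fun j _ => hnn _ j)
    have hmem : R ∈ a :: l ↔ R ∈ l := by simp [haR]
    simp only [hmem]
    by_cases hadj : G.Adj R a
    · have ha : a ∈ G.neighborFinset R := by simpa using hadj
      rw [← Finset.add_sum_erase _ _ ha] at ih ⊢
      rw [removedNorm_of_notMem x hl.1] at ih
      have hs : ∑ j ∈ (G.neighborFinset R).erase a, removedNorm P x (a :: l) j =
          ∑ j ∈ (G.neighborFinset R).erase a, removedNorm P x l j :=
        Finset.sum_congr rfl fun j hj => by
          rw [removedNorm, Function.update_of_ne (Finset.ne_of_mem_erase hj)]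
      rw [hs, removedNorm, Function.update_self]
      have h1 : ‖P R ((1 - P a) (complProd P l x))‖ ≤
          ‖P R (complProd P l x)‖ + ‖P a (complProd P l x)‖ := by
        have : P R ((1 - P a) (complProd P l x)) =
            P R (complProd P l x) - P R (P a (complProd P l x)) := by simp
        rw [this]
        exact (norm_sub_le _ _).trans (add_le_add le_rfl ((hP R).norm_apply_le _))
      linarith
    · have hs : ∑ j ∈ G.neighborFinset R, removedNorm P x (a :: l) j =
          ∑ j ∈ G.neighborFinset R, removedNorm P x l j :=
        Finset.sum_congr rfl fun j hj => by
          rw [removedNorm, Function.update_of_ne]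
          rintro rfl
          exact hadj (by simpa using hj)
      rw [hs]
      have hc : P R ((1 - P a) (complProd P l x)) = (1 - P a) (P R (complProd P l x)) :=
        congrArg (fun A : E →L[ℂ] E => A (complProd P l x))
          ((Commute.one_right (P R)).sub_right (hG R a hadj)).eq
      rw [hc]
      exact ((hP a).one_sub.norm_apply_le _).trans ih

open scoped Classical in
-- One factor `g` comes from Cauchy–Schwarz over the neighbours of `R`, the other from each `j`
-- being a neighbour of at most `g` labels.
theorem sum_norm_sq_apply_complProd_le [Fintype Λ] (hP : ∀ R, IsStarProjection (P R))
    (G : SimpleGraph Λ) (hG : ∀ R R', ¬ G.Adj R R' → Commute (P R) (P R')) {g : ℕ}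
    (hg : ∀ R, G.degree R ≤ g) (x : E) {l : List Λ} (hl : l.Nodup) (hall : ∀ R, R ∈ l) :
    ∑ R, ‖P R (complProd P l x)‖ ^ 2 ≤ (g : ℝ) ^ 2 * (‖x‖ ^ 2 - ‖complProd P l x‖ ^ 2) := by
  rw [← sum_removedNorm_sq hP x hl]
  set f := removedNorm P x l
  have h1 : ∀ R, ‖P R (complProd P l x)‖ ^ 2 ≤ g * ∑ j ∈ G.neighborFinset R, f j ^ 2 := by
    intro R
    have h := norm_apply_complProd_le hP G hG x hl R
    rw [if_pos (hall R), zero_add] at h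
    calc _ ≤ (∑ j ∈ G.neighborFinset R, f j) ^ 2 := pow_le_pow_left₀ (norm_nonneg _) h 2
      _ ≤ (G.neighborFinset R).card * ∑ j ∈ G.neighborFinset R, f j ^ 2 :=
        sq_sum_le_card_mul_sum_sq
      _ ≤ _ := by
        gcongr
        simpa using hg R
  calc _ ≤ ∑ R, g * ∑ j ∈ G.neighborFinset R, f j ^ 2 := Finset.sum_le_sum fun R _ => h1 R
    _ = g * ∑ j, ∑ R ∈ G.neighborFinset j, f j ^ 2 := by
      rw [← Finset.mul_sum]
      congr 1
      apply Finset.sum_comm'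
      intro a b
      simp [SimpleGraph.adj_comm]
    _ = g * ∑ j, G.degree j * f j ^ 2 := by simp
    _ ≤ g * ∑ j, g * f j ^ 2 := by
      gcongr with j
      exact hg j
    _ = _ := by rw [← Finset.mul_sum]; ring

open scoped Classical in
/-- The detectability lemma. -/
theorem norm_sq_complProd_apply_le [Fintype Λ] (hP : ∀ R, IsStarProjection (P R))
    (G : SimpleGraph Λ) (hG : ∀ R R', ¬ G.Adj R R' → Commute (P R) (P R')) {g : ℕ}
    (hg : ∀ R, G.degree R ≤ g) {ε : ℝ} (hε : 0 < ε)
    (hgap : ∀ x ∈ (commonKer P)ᗮ, ε * ‖x‖ ^ 2 ≤ ∑ R, ‖P R x‖ ^ 2)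
    {x : E} (hx : x ∈ (commonKer P)ᗮ) {l : List Λ} (hl : l.Nodup) (hall : ∀ R, R ∈ l) :
    ‖complProd P l x‖ ^ 2 ≤ (1 - ε / ((g : ℝ) ^ 2 + ε)) * ‖x‖ ^ 2 := by
  -- With `T x ∈ Kᗮ`, the gap gives `ε ‖T x‖² ≤ g² (‖x‖² - ‖T x‖²)`, to be solved for `‖T x‖²`.
  have h1 := hgap _ (complProd_apply_mem_orthogonal hP hx l)
  have h2 := sum_norm_sq_apply_complProd_le hP G hG hg x hl hall
  have h3 : (0 : ℝ) < (g : ℝ) ^ 2 + ε := by positivity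
  have h4 : 1 - ε / ((g : ℝ) ^ 2 + ε) = (g : ℝ) ^ 2 / ((g : ℝ) ^ 2 + ε) := by
    field_simp; ring
  rw [h4, div_mul_eq_mul_div, le_div_iff₀ h3]
  linarith

theorem inner_apply_complProd_apply_eq (hP : ∀ R, IsStarProjection (P R)) {A B : E →L[ℂ] E}
    {x : E} (hx : x ∈ commonKer P) {l : List Λ} (hA : ∀ R ∈ l, Commute (P R) A) :
    inner ℂ x (A (complProd P l (B x))) = inner ℂ x (A (B x)) := by
  have h : A (complProd P l (B x)) = complProd P l (A (B x)) :=
    congrArg (fun C : E →L[ℂ] E => C (B x)) (commute_complProd hA).eq.symm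
  rw [h]
  have h2 := inner_complProd_left hP l.reverse x (A (B x))
  rw [List.reverse_reverse, complProd_apply_of_mem hx] at h2
  exact h2.symm

/-! ### Powers of the symmetrized product of layers -/

theorem complProd_mul_self (hP : ∀ R, IsStarProjection (P R)) {l : List Λ}
    (hl : ∀ R ∈ l, ∀ R' ∈ l, Commute (P R) (P R')) :
    complProd P l * complProd P l = complProd P l := by
  induction l with
  | nil => simp
  | cons R l ih =>
    have ih := ih fun R hR R' hR' => hl R (by simp [hR]) R' (by simp [hR'])
    have hc : Commute (complProd P l) (1 - P R) :=
      (Commute.one_right _).sub_right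
        (commute_complProd fun R' hR' => hl R' (by simp [hR']) R (by simp))
    rw [complProd_cons, hc.mul_mul_mul_comm, ih, (hP R).one_sub.isIdempotentElem.eq]

/-- Adjacent equal layers merge, so that a power of `T† T`, for `T` a product of `c` layers, has
only `2 (c - 1)` layers for each factor, up to one more layer in total. -/
theorem exists_layers_pow_succ (hP : ∀ R, IsStarProjection (P R)) (X Y : List Λ)
    (mid : List (List Λ))
    (hls : ∀ l ∈ X :: (mid ++ [Y]), ∀ R ∈ l, ∀ R' ∈ l, Commute (P R) (P R')) (k : ℕ) :
    ∃ ls : List (List Λ), ls.length = (k + 1) * (2 * mid.length + 2) + 1 ∧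
      (∀ l ∈ ls, ∀ R ∈ l, ∀ R' ∈ l, Commute (P R) (P R')) ∧
      (star (complProd P (X :: (mid ++ [Y])).flatten) *
        complProd P (X :: (mid ++ [Y])).flatten) ^ (k + 1) = complProd P ls.flatten := by
  have hXX := complProd_mul_self hP (hls X (by simp))
  have hYY := complProd_mul_self hP (hls Y (by simp))
  have hXr := complProd_reverse X (hls X (by simp))
  have hYr := complProd_reverse Y (hls Y (by simp))
  have hMr : complProd P mid.flatten.reverse = complProd P mid.reverse.flatten := by
    have hm : ∀ l ∈ mid, ∀ R ∈ l, ∀ R' ∈ l, Commute (P R) (P R') := fun l hl =>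
      hls l (by simp [hl])
    clear hls
    induction mid with
    | nil => rfl
    | cons l mid ih =>
      simp only [List.flatten_cons, List.reverse_append, complProd_append, List.reverse_cons,
        List.flatten_append, List.flatten_nil, complProd_nil, mul_one]
      rw [ih fun l hl => hm l (by simp [hl]), complProd_reverse l (hm l (by simp))]
  -- Merging the two `X` layers gives `T† T = U Y`. Since `U` starts with `Y`, also `Y U = U`, hence
  -- `(U Y)^(k+1) = U^(k+1) Y`.
  set U : List (List Λ) := Y :: (mid.reverse ++ X :: mid) with hU
  have hA : star (complProd P (X :: (mid ++ [Y])).flatten) *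
      complProd P (X :: (mid ++ [Y])).flatten = complProd P U.flatten * complProd P Y := by
    rw [adjoint_complProd hP]
    simp only [hU, List.flatten_cons, List.flatten_append, List.reverse_append, complProd_append,
      List.flatten_nil, List.append_nil, hXr, hYr, hMr, mul_assoc]
    rw [← mul_assoc (complProd P X) (complProd P X), hXX]
  have hYU : complProd P Y * complProd P U.flatten = complProd P U.flatten := by
    rw [hU, List.flatten_cons, complProd_append, ← mul_assoc, hYY]
  have hUl : ∀ l ∈ U, ∀ R ∈ l, ∀ R' ∈ l, Commute (P R) (P R') := by
    intro l hl
    apply hls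
    simp only [hU, List.mem_cons, List.mem_append, List.mem_reverse] at hl ⊢
    tauto
  rw [hA]
  induction k with
  | zero =>
    refine ⟨U ++ [Y], ?_, ?_, ?_⟩
    · simp [hU]; ring
    · intro l hl
      rcases List.mem_append.1 hl with h | h
      · exact hUl l h
      · exact hls l (by simp_all)
    · simp
  | succ k ih =>
    obtain ⟨ls, h1, h2, h3⟩ := ih
    refine ⟨U ++ ls, ?_, ?_, ?_⟩
    · simp [hU, h1]; ring
    · intro l hl
      rcases List.mem_append.1 hl with h | h
      · exact hUl l h
      · exact h2 l h
    · rw [List.flatten_append, complProd_append, ← h3, pow_succ' _ (k + 1), pow_succ']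
      simp only [mul_assoc]
      rw [← mul_assoc (complProd P Y) (complProd P U.flatten), hYU]

end Projections

/-! ### Spectral estimates in finite dimension -/

section Spectral

variable {E : Type*} [NormedAddCommGroup E] [InnerProductSpace ℂ E] [FiniteDimensional ℂ E]

/-- A polynomial in `T† T` is bounded on `Kᗮ` by its maximum over the possible eigenvalues. -/
theorem norm_sum_coeff_smul_pow_apply_le {T A : E →L[ℂ] E}
    (hA : A = ContinuousLinearMap.adjoint T * T) {K : Submodule ℂ E} (hK : ∀ x ∈ K, A x = x)
    (hKo : ∀ x ∈ Kᗮ, A x ∈ Kᗮ) {q : ℝ} (hq : ∀ x ∈ Kᗮ, ‖T x‖ ^ 2 ≤ q * ‖x‖ ^ 2)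
    {p : Polynomial ℝ} {m : ℕ} (hm : p.natDegree ≤ m) {η : ℝ}
    (hη : ∀ t ∈ Set.Icc 0 q, |p.eval t| ≤ η) (hη0 : 0 ≤ η) {x : E} (hx : x ∈ Kᗮ) :
    ‖∑ k ∈ Finset.range (m + 1), ((p.coeff k : ℝ) : ℂ) • (A ^ k) x‖ ≤ η * ‖x‖ := by
  have hsymm : (A : E →ₗ[ℂ] E).IsSymmetric := by
    intro x y
    simp [hA, ContinuousLinearMap.adjoint_inner_left, ContinuousLinearMap.adjoint_inner_right]
  have hinner : ∀ y z : E, inner ℂ (A y) z = inner ℂ y (A z) := hsymm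
  set b := hsymm.eigenvectorBasis rfl
  set ev := hsymm.eigenvalues rfl
  have hb : ∀ i, A (b i) = (ev i : ℂ) • b i := fun i => hsymm.apply_eigenvectorBasis rfl i
  have hpow : ∀ i k, inner ℂ (b i) ((A ^ k) x) = (ev i : ℂ) ^ k * inner ℂ (b i) x := by
    intro i k
    induction k with
    | zero => simp
    | succ k ih =>
      rw [pow_succ', mul_apply_eq_comp, ← hinner, hb, inner_smul_left, ih]
      simp [pow_succ', mul_assoc]
  have hev : ∀ i, inner ℂ (b i) x ≠ 0 → ev i ∈ Set.Icc 0 q := by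
    intro i hi
    -- The eigenvector `b i` need not lie in `Kᗮ`, but its component `w` there is nonzero and is an
    -- eigenvector for the same eigenvalue, because `A w - ev i • w` lies in `K ∩ Kᗮ`.
    set w := b i - K.starProjection (b i) with hw
    have hwK : w ∈ Kᗮ := K.sub_starProjection_mem_orthogonal (b i)
    have hwx : inner ℂ (b i) x = inner ℂ w x := by
      rw [hw, inner_sub_left, (Submodule.mem_orthogonal K x).1 hx _ (K.starProjection_apply_mem _),
        sub_zero]
    have hw0 : w ≠ 0 := by
      intro h
      rw [hwx, h, inner_zero_left] at hi
      exact hi rfl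
    have hAw : A w = (ev i : ℂ) • w := by
      have h1 : A w - (ev i : ℂ) • w = ((ev i : ℂ) - 1) • K.starProjection (b i) := by
        rw [hw, map_sub, hb, hK _ (K.starProjection_apply_mem _)]
        module
      have h2 : A w - (ev i : ℂ) • w ∈ Kᗮ := Kᗮ.sub_mem (hKo w hwK) (Kᗮ.smul_mem _ hwK)
      have h3 : A w - (ev i : ℂ) • w ∈ K := by
        rw [h1]
        exact K.smul_mem _ (K.starProjection_apply_mem _)
      exact sub_eq_zero.1 (inner_self_eq_zero.1 ((Submodule.mem_orthogonal K _).1 h2 _ h3))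
    have h4 : ‖T w‖ ^ 2 = ev i * ‖w‖ ^ 2 := by
      have h5 : inner ℂ w (A w) = ((‖T w‖ ^ 2 : ℝ) : ℂ) := by
        rw [hA, mul_apply_eq_comp, ContinuousLinearMap.adjoint_inner_right,
          inner_self_eq_norm_sq_to_K]
        simp
      rw [hAw, inner_smul_right, inner_self_eq_norm_sq_to_K] at h5
      refine Complex.ofReal_injective ?_
      rw [← h5]
      simp
    have hn : 0 < ‖w‖ ^ 2 := by positivity
    have h6 := hq w hwK
    rw [h4] at h6
    refine ⟨?_, le_of_mul_le_mul_right h6 hn⟩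
    by_contra hneg
    nlinarith [sq_nonneg ‖T w‖]
  rw [← sq_le_sq₀ (norm_nonneg _) (by positivity), mul_pow, ← b.sum_sq_norm_inner_right,
    ← b.sum_sq_norm_inner_right, Finset.mul_sum]
  refine Finset.sum_le_sum fun i _ => ?_
  have hs : inner ℂ (b i) (∑ k ∈ Finset.range (m + 1), ((p.coeff k : ℝ) : ℂ) • (A ^ k) x) =
      ((p.eval (ev i) : ℝ) : ℂ) * inner ℂ (b i) x := by
    rw [inner_sum, Polynomial.eval_eq_sum_range' (Nat.lt_succ_of_le hm)]
    simp only [Complex.ofReal_sum, Complex.ofReal_mul, Complex.ofReal_pow]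
    rw [Finset.sum_mul]
    refine Finset.sum_congr rfl fun k _ => ?_
    rw [inner_smul_right, hpow, mul_assoc]
  rw [hs, norm_mul, mul_pow]
  by_cases hi : inner ℂ (b i) x = 0
  · simp [hi]
  · gcongr
    simpa using hη _ (hev i hi)

/-- The lowest positive eigenvalue of a positive operator bounds it from below on the orthogonal
complement of its kernel. -/
theorem mul_norm_sq_le_re_inner_of_forall_hasEigenvalue {H : E →L[ℂ] E} (hH : H.IsPositive) {ε : ℝ}
    (hε : ∀ t : ℝ, 0 < t → Module.End.HasEigenvalue (H : Module.End ℂ E) (t : ℂ) → ε ≤ t)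
    {x : E} (hx : x ∈ (LinearMap.ker (H : E →ₗ[ℂ] E))ᗮ) :
    ε * ‖x‖ ^ 2 ≤ RCLike.re (inner ℂ x (H x)) := by
  have hsymm : (H : E →ₗ[ℂ] E).IsSymmetric := hH.isSymmetric
  set b := hsymm.eigenvectorBasis rfl
  set ev := hsymm.eigenvalues rfl
  have hb : ∀ i, H (b i) = (ev i : ℂ) • b i := fun i => hsymm.apply_eigenvectorBasis rfl i
  have h1 : inner ℂ x (H x) = ∑ i, ((ev i * ‖inner ℂ (b i) x‖ ^ 2 : ℝ) : ℂ) := by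
    rw [← b.sum_inner_mul_inner]
    refine Finset.sum_congr rfl fun i _ => ?_
    have : inner ℂ (b i) (H x) = (ev i : ℂ) * inner ℂ (b i) x := by
      have h2 : inner ℂ (H (b i)) x = inner ℂ (b i) (H x) := hsymm _ _
      rw [← h2, hb, inner_smul_left]
      simp
    rw [this, mul_left_comm, ← inner_conj_symm x (b i), RCLike.conj_mul]
    push_cast
    rfl
  rw [h1, ← Complex.ofReal_sum]
  change _ ≤ (Complex.ofReal _).re
  rw [Complex.ofReal_re, ← b.sum_sq_norm_inner_right x, Finset.mul_sum]
  refine Finset.sum_le_sum fun i _ => ?_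
  by_cases hi : ev i = 0
  · have hk : b i ∈ LinearMap.ker (H : E →ₗ[ℂ] E) := by
      rw [LinearMap.mem_ker]
      change H (b i) = 0
      rw [hb, hi]; simp
    rw [(Submodule.mem_orthogonal _ x).1 hx _ hk]
    simp
  · have hnn : 0 ≤ ev i := by
      have h3 := hH.re_inner_nonneg_right (b i)
      rw [hb, inner_smul_right, inner_self_eq_norm_sq_to_K] at h3
      simpa using h3
    gcongr
    exact hε _ (lt_of_le_of_ne hnn (Ne.symm hi)) (hsymm.hasEigenvalue_eigenvalues rfl i)

end Spectral

/-! ### Decay of correlations for families of projectors -/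

section LightCone

variable {E : Type*} [NormedAddCommGroup E] [InnerProductSpace ℂ E] [FiniteDimensional ℂ E]
variable {Λ : Type*} {P : Λ → E →L[ℂ] E}

/-- Fewer layers than the distance between `A` and `B` do not affect their correlation. -/
theorem inner_apply_complProd_flatten_apply_eq (hP : ∀ R, IsStarProjection (P R))
    {G : SimpleGraph Λ} (hG : ∀ R R', ¬ G.Adj R R' → Commute (P R) (P R')) {A B : E →L[ℂ] E}
    {D : ℕ∞} (hD : ∀ R, ¬ Commute (P R) A → ∀ R', ¬ Commute (P R') B → D ≤ G.edist R R')
    {x : E} (hx : x ∈ commonKer P) {ls : List (List Λ)} (hlen : (ls.length : ℕ∞) ≤ D)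
    (hls : ∀ l ∈ ls, ∀ R ∈ l, ∀ R' ∈ l, Commute (P R) (P R')) :
    inner ℂ x (A (complProd P ls.flatten (B x))) = inner ℂ x (A (B x)) := by
  -- The strict inequality makes `S 0` empty, so that `n` layers reach distance at most `n - 1` and
  -- `D` layers are still allowed.
  set S : ℕ → Set Λ := fun n => {R | ∃ R', ¬ Commute (P R') B ∧ G.edist R R' < n} with hSdef
  have hmono : Monotone S := by
    rintro m n hmn R ⟨R', h1, h2⟩
    exact ⟨R', h1, h2.trans_le (by exact_mod_cast hmn)⟩
  have hS : ∀ n, ∀ R ∉ S (n + 1), ∀ R' ∈ S n, Commute (P R) (P R') := by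
    rintro n R hR R' ⟨R₀, h1, h2⟩
    apply hG
    intro hadj
    refine hR ⟨R₀, h1, ?_⟩
    have h3 : G.edist R R' = 1 := SimpleGraph.edist_eq_one_iff_adj.2 hadj
    have h4 : G.edist R R₀ ≤ 1 + G.edist R' R₀ := h3 ▸ G.edist_triangle
    refine h4.trans_lt ?_
    push_cast
    rw [add_comm]
    exact (ENat.add_lt_add_iff_right ENat.one_ne_top).2 h2
  have hB : ∀ n, ∀ R ∉ S (n + 1), Commute (P R) B := by
    intro n R hR
    by_contra h
    exact hR ⟨R, h, by rw [SimpleGraph.edist_self]; exact_mod_cast Nat.succ_pos n⟩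
  obtain ⟨w, hw, he⟩ := exists_complProd_flatten_apply_eq hmono hS hB hx ls hls
  rw [he]
  refine inner_apply_complProd_apply_eq hP hx fun R hR => ?_
  by_contra hA
  obtain ⟨R', h1, h2⟩ := hw R hR
  exact absurd (hlen.trans (hD R hA R' h1)) (not_le.2 h2)

theorem norm_inner_apply_le (A : E →L[ℂ] E) (x y : E) :
    ‖inner ℂ x (A y)‖ ≤ ‖ContinuousLinearMap.adjoint A x‖ * ‖y‖ := by
  rw [← ContinuousLinearMap.adjoint_inner_left]
  exact norm_inner_le_norm _ _

variable [Fintype Λ]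

open scoped Classical in
/-- Exponential decay of correlations in terms of a bound `g` on the degree and a colouring of the
interaction graph. -/
theorem norm_inner_sub_starProjection_le (hP : ∀ R, IsStarProjection (P R))
    {G : SimpleGraph Λ} (hG : ∀ R R', ¬ G.Adj R R' → Commute (P R) (P R')) {g : ℕ} (hg0 : 0 < g)
    (hg : ∀ R, G.degree R ≤ g) {c : ℕ} (hc : 2 ≤ c) (hcol : G.Colorable c) {ε : ℝ} (hε : 0 < ε)
    (hgap : ∀ x ∈ (commonKer P)ᗮ, ε * ‖x‖ ^ 2 ≤ ∑ R, ‖P R x‖ ^ 2) {A B : E →L[ℂ] E}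
    {D : ℕ} (hD : ∀ R, ¬ Commute (P R) A → ∀ R', ¬ Commute (P R') B → (D : ℕ∞) ≤ G.edist R R')
    {x : E} (hx : x ∈ commonKer P) :
    ‖inner ℂ x (A (B x - (commonKer P).starProjection (B x)))‖ ≤
      2 * Real.exp 1 ^ 2 *
        Real.exp (-(((D : ℝ) - 1) / ((c : ℝ) - 1) * √(ε / ((g : ℝ) ^ 2 + ε)))) *
      (‖ContinuousLinearMap.adjoint A x‖ * ‖B x‖) := by
  set δ := ε / ((g : ℝ) ^ 2 + ε) with hδ
  have hg' : (0 : ℝ) < g := by exact_mod_cast hg0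
  have hδ0 : 0 < δ := by positivity
  have hδ1 : δ < 1 := by
    rw [hδ, div_lt_one (by positivity)]
    have := pow_pos hg' 2
    linarith
  set K := commonKer P with hK
  -- The largest degree with `2 (c - 1) m + 1 ≤ D`; for `D = 0` truncated subtraction gives `m = 0`,
  -- where only the power `0` occurs.
  set m := (D - 1) / (2 * (c - 1)) with hm
  obtain ⟨p, hpm, hp1, hpη⟩ := exists_polynomial_le_exp hδ0 hδ1 m
  -- the layers
  obtain ⟨κ⟩ := hcol
  set cs : List (List Λ) := (List.finRange c).map fun i =>
    (Finset.univ.toList : List Λ).filter (fun R => κ R = i) with hcs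
  have hcslen : cs.length = c := by simp [hcs]
  have hcscomm : ∀ l ∈ cs, ∀ R ∈ l, ∀ R' ∈ l, Commute (P R) (P R') := by
    intro l hl R hR R' hR'
    obtain ⟨i, -, rfl⟩ := List.mem_map.1 hl
    simp only [List.mem_filter, decide_eq_true_eq] at hR hR'
    exact hG R R' fun hadj => κ.valid hadj (hR.2.trans hR'.2.symm)
  have hall : ∀ R, R ∈ cs.flatten := by
    intro R
    rw [List.mem_flatten]
    exact ⟨_, List.mem_map.2 ⟨κ R, List.mem_finRange _, rfl⟩, by simp⟩
  have hnodup : cs.flatten.Nodup := by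
    rw [List.nodup_flatten]
    refine ⟨?_, ?_⟩
    · intro l hl
      obtain ⟨i, -, rfl⟩ := List.mem_map.1 hl
      exact (Finset.nodup_toList _).filter _
    · rw [hcs, List.pairwise_map]
      refine (List.nodup_finRange c).imp ?_
      intro i j hij R hR hR'
      simp only [List.mem_filter, decide_eq_true_eq] at hR hR'
      exact hij (hR.2.symm.trans hR'.2)
  obtain ⟨X, mid, Y, hXY⟩ : ∃ X mid Y, cs = X :: (mid ++ [Y]) := by
    obtain ⟨X, rest, h⟩ := List.exists_cons_of_ne_nil (l := cs) (by
      intro h; rw [h] at hcslen; simp at hcslen; omega)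
    refine ⟨X, rest.dropLast, rest.getLast ?_, ?_⟩
    · intro h2; rw [h, h2] at hcslen; simp at hcslen; omega
    · rw [List.dropLast_append_getLast, h]
  have hmid : 2 * mid.length + 2 = 2 * (c - 1) := by
    rw [hXY] at hcslen
    simp at hcslen
    omega
  set T := complProd P cs.flatten with hT
  set Z : E →L[ℂ] E := star T * T with hZ
  -- low powers do not see the correlation
  have hlow : ∀ k ≤ m, inner ℂ x (A ((Z ^ k) (B x))) = inner ℂ x (A (B x)) := by
    intro k hk
    rcases k with _ | k
    · simp
    obtain ⟨ls, h1, h2, h3⟩ := exists_layers_pow_succ hP X Y mid (hXY ▸ hcscomm) k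
    rw [← hXY] at h3
    rw [hZ, hT, h3]
    refine inner_apply_complProd_flatten_apply_eq hP hG hD hx ?_ h2
    rw [h1, hmid]
    have h4 : (k + 1) * (2 * (c - 1)) ≤ D - 1 :=
      (Nat.mul_le_mul_right _ hk).trans (Nat.div_mul_le_self _ _)
    have h5 : 0 < (k + 1) * (2 * (c - 1)) := Nat.mul_pos (Nat.succ_pos k) (by omega)
    exact_mod_cast (by omega : (k + 1) * (2 * (c - 1)) + 1 ≤ D)
  have hZK : ∀ y ∈ K, Z y = y := by
    intro y hy
    rw [hZ, hT, adjoint_complProd hP, mul_apply_eq_comp, complProd_apply_of_mem hy,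
      complProd_apply_of_mem hy]
  have hZKk : ∀ y ∈ K, ∀ k, (Z ^ k) y = y := by
    intro y hy k
    induction k with
    | zero => simp
    | succ k ih => rw [pow_succ, mul_apply_eq_comp, hZK y hy, ih]
  have hZKo : ∀ y ∈ Kᗮ, Z y ∈ Kᗮ := by
    intro y hy
    rw [hZ, hT, adjoint_complProd hP]
    exact complProd_apply_mem_orthogonal hP (complProd_apply_mem_orthogonal hP hy _) _
  have hbound := norm_sum_coeff_smul_pow_apply_le (T := T) (A := Z)
    (by rw [hZ, ContinuousLinearMap.star_eq_adjoint]) hZK hZKo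
    (fun y hy => norm_sq_complProd_apply_le hP G hG hg hε hgap hy hnodup hall) hpm hpη
    (by positivity) (K.sub_starProjection_mem_orthogonal (B x))
  have hcoef : ∑ k ∈ Finset.range (m + 1), ((p.coeff k : ℝ) : ℂ) = 1 := by
    rw [← Complex.ofReal_sum, ← Complex.ofReal_one, ← hp1,
      Polynomial.eval_eq_sum_range' (Nat.lt_succ_of_le hpm)]
    simp
  -- Each power leaves both `B x` and its projection unchanged under `⟨x, A ·⟩`, and the
  -- coefficients sum to `p(1) = 1`.
  have hkey : inner ℂ x (A (B x - K.starProjection (B x))) =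
      inner ℂ x (A (∑ k ∈ Finset.range (m + 1),
        ((p.coeff k : ℝ) : ℂ) • (Z ^ k) (B x - K.starProjection (B x)))) := by
    rw [map_sum, inner_sum]
    have : ∀ k ∈ Finset.range (m + 1), inner ℂ x (A (((p.coeff k : ℝ) : ℂ) •
        (Z ^ k) (B x - K.starProjection (B x)))) =
        ((p.coeff k : ℝ) : ℂ) * inner ℂ x (A (B x - K.starProjection (B x))) := by
      intro k hk
      rw [map_smul, inner_smul_right, map_sub, hZKk _ (K.starProjection_apply_mem _), map_sub,
        inner_sub_right, hlow k (Nat.lt_succ_iff.1 (Finset.mem_range.1 hk)), map_sub,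
        inner_sub_right]
    rw [Finset.sum_congr rfl this, ← Finset.sum_mul, hcoef, one_mul]
  rw [hkey]
  have hfin : ‖B x - K.starProjection (B x)‖ ≤ ‖B x‖ := by
    have h := Kᗮ.norm_starProjection_apply_le (B x)
    rwa [Submodule.starProjection_orthogonal_val] at h
  -- Rounding gives `(D - 1) / (c - 1) ≤ 2 m + 2`; as `√δ ≤ 1`, this loses at most the factor `e²`.
  have hexp : 2 * Real.exp (-(2 * m * √δ)) ≤ 2 * Real.exp 1 ^ 2 *
      Real.exp (-(((D : ℝ) - 1) / ((c : ℝ) - 1) * √δ)) := by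
    rw [← Real.exp_nat_mul, mul_assoc 2 (Real.exp _), ← Real.exp_add]
    gcongr
    have hs0 : 0 ≤ √δ := Real.sqrt_nonneg _
    have hs1 : √δ ≤ 1 := Real.sqrt_le_one.2 hδ1.le
    have hc1 : (0 : ℝ) < (c : ℝ) - 1 := by
      have : (2 : ℝ) ≤ c := by exact_mod_cast hc
      linarith
    have h1 : ((D : ℝ) - 1) / ((c : ℝ) - 1) ≤ 2 * m + 2 := by
      rw [div_le_iff₀ hc1]
      have h2 : D - 1 < (m + 1) * (2 * (c - 1)) := by
        rw [hm, mul_comm]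
        exact Nat.lt_mul_div_succ _ (by omega)
      have h3 : D ≤ (m + 1) * (2 * (c - 1)) + 1 := by omega
      have h4 : (D : ℝ) ≤ (m + 1) * (2 * ((c : ℝ) - 1)) + 1 := by
        have : ((c - 1 : ℕ) : ℝ) = (c : ℝ) - 1 := by
          rw [Nat.cast_sub (by omega)]; simp
        rw [← this]
        exact_mod_cast h3
      linarith
    have := mul_le_mul_of_nonneg_right h1 hs0
    push_cast
    linarith
  calc _ ≤ _ := norm_inner_apply_le A x _
    _ ≤ ‖ContinuousLinearMap.adjoint A x‖ *
        (2 * Real.exp (-(2 * m * √δ)) * ‖B x - K.starProjection (B x)‖) := by gcongr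
    _ ≤ ‖ContinuousLinearMap.adjoint A x‖ * (2 * Real.exp 1 ^ 2 *
      Real.exp (-(((D : ℝ) - 1) / ((c : ℝ) - 1) * √δ)) * ‖B x‖) := by gcongr
    _ = _ := by ring

open scoped Classical in
/-- Operators in different components of the interaction graph are uncorrelated. -/
theorem inner_sub_starProjection_eq_zero (hP : ∀ R, IsStarProjection (P R))
    {G : SimpleGraph Λ} (hG : ∀ R R', ¬ G.Adj R R' → Commute (P R) (P R')) {ε : ℝ} (hε : 0 < ε)
    (hgap : ∀ x ∈ (commonKer P)ᗮ, ε * ‖x‖ ^ 2 ≤ ∑ R, ‖P R x‖ ^ 2) {A B : E →L[ℂ] E}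
    (hD : ∀ R, ¬ Commute (P R) A → ∀ R', ¬ Commute (P R') B → G.edist R R' = ⊤)
    {x : E} (hx : x ∈ commonKer P) :
    inner ℂ x (A (B x - (commonKer P).starProjection (B x))) = 0 := by
  set K := commonKer P with hK
  set T := complProd P (Finset.univ.toList : List Λ) with hT
  set δ := ε / ((G.maxDegree : ℝ) ^ 2 + ε) with hδ
  have hδ0 : 0 < δ := by positivity
  have hδ1 : δ ≤ 1 := by
    rw [hδ, div_le_one (by positivity)]
    have := sq_nonneg (G.maxDegree : ℝ)
    linarith
  set y := B x - K.starProjection (B x) with hy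
  have hyK : y ∈ Kᗮ := K.sub_starProjection_mem_orthogonal (B x)
  have hword : ∀ k, T ^ k = complProd P (List.replicate k (Finset.univ.toList : List Λ)).flatten := by
    intro k
    induction k with
    | zero => simp
    | succ k ih => rw [pow_succ', ih, List.replicate_succ, List.flatten_cons, complProd_append]
  -- At infinite distance the number of layers is irrelevant, so each factor can be its own layer
  -- and no colouring is needed. All powers of `T` then preserve the correlation, while they decay
  -- on `Kᗮ`.
  have hsingle : ∀ l : List Λ, (l.map fun R => [R]).flatten = l := by
    intro l
    induction l with
    | nil => rfl
    | cons a l ih => simp [ih]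
  have hconst : ∀ k, inner ℂ x (A ((T ^ k) y)) = inner ℂ x (A y) := by
    intro k
    set l := (List.replicate k (Finset.univ.toList : List Λ)).flatten
    have h1 : inner ℂ x (A ((T ^ k) (B x))) = inner ℂ x (A (B x)) := by
      have hl : T ^ k = complProd P (l.map fun R => [R]).flatten := by rw [hsingle, hword]
      rw [hl]
      refine inner_apply_complProd_flatten_apply_eq hP hG (D := ⊤)
        (fun R hR R' hR' => (hD R hR R' hR').ge) hx le_top ?_
      intro l' hl' R hR R' hR'
      obtain ⟨a, -, rfl⟩ := List.mem_map.1 hl'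
      rw [List.mem_singleton.1 hR, List.mem_singleton.1 hR']
    have h2 : (T ^ k) (K.starProjection (B x)) = K.starProjection (B x) := by
      rw [hword]
      exact complProd_apply_of_mem (K.starProjection_apply_mem _) _
    rw [hy, map_sub, h2, map_sub, inner_sub_right, h1, map_sub, inner_sub_right]
  have hdecay : ∀ k, (T ^ k) y ∈ Kᗮ ∧ ‖(T ^ k) y‖ ^ 2 ≤ (1 - δ) ^ k * ‖y‖ ^ 2 := by
    intro k
    induction k with
    | zero => simpa using hyK
    | succ k ih =>
      rw [pow_succ', mul_apply_eq_comp]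
      refine ⟨complProd_apply_mem_orthogonal hP ih.1 _, ?_⟩
      have h := norm_sq_complProd_apply_le hP G hG (fun R => G.degree_le_maxDegree R) hε hgap ih.1
        (Finset.nodup_toList Finset.univ) (fun R => by simp)
      refine h.trans ?_
      rw [pow_succ' (1 - δ), mul_assoc]
      exact mul_le_mul_of_nonneg_left ih.2 (by linarith)
  have hle : ∀ k : ℕ, ‖inner ℂ x (A y)‖ ^ 2 ≤
      ‖ContinuousLinearMap.adjoint A x‖ ^ 2 * ((1 - δ) ^ k * ‖y‖ ^ 2) := by
    intro k
    rw [← hconst k]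
    calc _ ≤ (‖ContinuousLinearMap.adjoint A x‖ * ‖(T ^ k) y‖) ^ 2 :=
          pow_le_pow_left₀ (norm_nonneg _) (norm_inner_apply_le A x _) 2
      _ ≤ _ := by
        rw [mul_pow]
        exact mul_le_mul_of_nonneg_left (hdecay k).2 (sq_nonneg _)
  have hlim : Tendsto (fun k : ℕ => ‖ContinuousLinearMap.adjoint A x‖ ^ 2 *
      ((1 - δ) ^ k * ‖y‖ ^ 2)) atTop (𝓝 0) := by
    have h := tendsto_pow_atTop_nhds_zero_of_lt_one (r := 1 - δ) (by linarith) (by linarith)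
    simpa using (h.mul_const (‖y‖ ^ 2)).const_mul (‖ContinuousLinearMap.adjoint A x‖ ^ 2)
  have h0 := ge_of_tendsto' hlim hle
  exact norm_eq_zero.1 (pow_eq_zero_iff two_ne_zero |>.1 (le_antisymm h0 (sq_nonneg _)))

end LightCone

/-! ### From the Hamiltonian to its projectors -/

theorem ContinuousLinearMap.IsPositive.apply_eq_zero_of_re_inner_eq_zero {E : Type*}
    [NormedAddCommGroup E] [InnerProductSpace ℂ E] {A : E →L[ℂ] E}
    (hA : A.IsPositive) {x : E} (hx : RCLike.re (inner ℂ x (A x)) = 0) : A x = 0 := by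
  by_contra hne
  have hsymm : ∀ y z, inner ℂ (A y) z = inner ℂ y (A z) := hA.isSymmetric
  set n : ℝ := ‖A x‖ ^ 2 with hn
  have hn0 : 0 < n := by positivity
  set r : ℝ := RCLike.re (inner ℂ (A x) (A (A x))) with hr
  -- Positivity along `x + t A x`: the quadratic form has no constant term, so its positive linear
  -- coefficient `2 n` is contradicted by a small negative `t`.
  have h : ∀ t : ℝ, 0 ≤ 2 * t * n + t ^ 2 * r := by
    intro t
    have h1 := hA.re_inner_nonneg_right (x + (t : ℂ) • A x)
    have h2 : inner ℂ x (A (A x)) = inner ℂ (A x) (A x) := (hsymm _ _).symm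
    have h3 : RCLike.re (inner ℂ (A x) (A x)) = n := inner_self_eq_norm_sq _
    simp only [map_add, map_smul, inner_add_left, inner_add_right, inner_smul_left,
      inner_smul_right, h2, hx, Complex.conj_ofReal] at h1
    simp only [RCLike.re_to_complex, Complex.re_ofReal_mul, Complex.add_re] at h1 h3 hr
    rw [h3, ← hr] at h1
    nlinarith
  have h5 := h (-(n / (|r| + 1)))
  have hr0 : 0 < |r| + 1 := by positivity
  have h6 : n / (|r| + 1) * (|r| + 1) = n := div_mul_cancel₀ _ hr0.ne'
  set w := n / (|r| + 1)
  have hw : 0 < w := by positivity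
  have h7 : w * r ≤ w * |r| := mul_le_mul_of_nonneg_left (le_abs_self r) hw.le
  have : 0 ≤ w * (w * r - 2 * n) := by linarith
  nlinarith [nonneg_of_mul_nonneg_right this hw]

theorem le_operatorDist_iff {M : Type u} {Λ : Type v} [Fintype M] {H : Λ → FockOp M}
    {O O' : FockOp M} {D : ℕ∞} :
    D ≤ operatorDist H O O' ↔ ∀ R, ¬ Commute (H R) O → ∀ R', ¬ Commute (H R') O' →
      D ≤ (interactionGraph H).edist R R' := by
  simp only [operatorDist, le_iInf_iff]

theorem commute_of_not_adj_interactionGraph {M : Type u} {Λ : Type v} [Fintype M]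
    {H : Λ → FockOp M} (R R' : Λ) (h : ¬ (interactionGraph H).Adj R R') :
    Commute (H R) (H R') := not_not.1 h

open scoped Classical in
theorem degree_le_interactionDegree {M : Type u} {Λ : Type v} [Fintype M] [Fintype Λ]
    (H : Λ → FockOp M) (R : Λ) : (interactionGraph H).degree R ≤ interactionDegree H :=
  SimpleGraph.degree_le_maxDegree _ R

namespace FrustrationFreeFermions

variable {M : Type u} {Λ : Type v} [Fintype M] [LinearOrder M] [Fintype Λ]
  (S : FrustrationFreeFermions M Λ)

theorem hamiltonian_apply (x : Fock M) : S.hamiltonian x = ∑ R, S.term R x := by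
  simp [hamiltonian]

theorem isPositive_hamiltonian : S.hamiltonian.IsPositive := by
  unfold hamiltonian
  exact ContinuousLinearMap.isPositive_sum _ fun R _ => S.pos R

theorem groundSpace_eq_commonKer : S.groundSpace = commonKer S.term := by
  ext x
  rw [mem_commonKer]
  constructor
  · intro hx R
    have hx0 : S.hamiltonian x = 0 := hx
    have h : ∑ R, RCLike.re (inner ℂ x (S.term R x)) = 0 := by
      rw [← map_sum, ← inner_sum, ← hamiltonian_apply, hx0]
      simp
    rw [Finset.sum_eq_zero_iff_of_nonneg fun R _ => (S.pos R).re_inner_nonneg_right x] at h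
    exact (S.pos R).apply_eq_zero_of_re_inner_eq_zero (h R (Finset.mem_univ R))
  · intro h
    change S.hamiltonian x = 0
    rw [hamiltonian_apply]
    simp [h]

theorem isStarProjection_termProj (R : Λ) : IsStarProjection (S.termProj R) :=
  isStarProjection_starProjection

theorem ker_termProj (R : Λ) : LinearMap.ker (S.termProj R : Fock M →ₗ[ℂ] Fock M) =
    LinearMap.ker (S.term R : Fock M →ₗ[ℂ] Fock M) := by
  unfold termProj
  rw [Submodule.ker_starProjection, Submodule.orthogonal_orthogonal]

theorem commonKer_termProj : commonKer S.termProj = S.groundSpace := by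
  rw [groundSpace_eq_commonKer]
  simp only [commonKer, ker_termProj]

theorem term_termProj_apply (R : Λ) (x : Fock M) : S.term R (S.termProj R x) = S.term R x := by
  have h : x - S.termProj R x ∈ LinearMap.ker (S.term R : Fock M →ₗ[ℂ] Fock M) := by
    rw [← ker_termProj, LinearMap.mem_ker]
    change S.termProj R (x - S.termProj R x) = 0
    rw [map_sub, (S.isStarProjection_termProj R).apply_apply, sub_self]
  have h2 : S.term R (x - S.termProj R x) = 0 := h
  rw [map_sub, sub_eq_zero] at h2
  exact h2.symm

/-- `H_R` does not see the component of `x` in its kernel, so the form can be evaluated at the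
projected vector. This transfers the gap to the projectors. -/
theorem re_inner_term_le {J : ℝ} {R : Λ} (hJ : ‖S.term R‖ ≤ J) (x : Fock M) :
    RCLike.re (inner ℂ x (S.term R x)) ≤ J * ‖S.termProj R x‖ ^ 2 := by
  have hsymm : ∀ y z, inner ℂ (S.term R y) z = inner ℂ y (S.term R z) := (S.pos R).isSymmetric
  have h : inner ℂ x (S.term R x) = inner ℂ (S.term R (S.termProj R x)) (S.termProj R x) := by
    rw [term_termProj_apply, hsymm, term_termProj_apply]
  rw [h]
  calc _ ≤ ‖inner ℂ (S.term R (S.termProj R x)) (S.termProj R x)‖ := RCLike.re_le_norm _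
    _ ≤ ‖S.term R (S.termProj R x)‖ * ‖S.termProj R x‖ := norm_inner_le_norm _ _
    _ ≤ (‖S.term R‖ * ‖S.termProj R x‖) * ‖S.termProj R x‖ := by
      gcongr
      exact (S.term R).le_opNorm _
    _ ≤ (J * ‖S.termProj R x‖) * ‖S.termProj R x‖ := by gcongr
    _ = _ := by ring

variable {S}

theorem IsGap.mul_norm_sq_le {ε : ℝ} (hε : S.IsGap ε) {x : Fock M} (hx : x ∈ S.groundSpaceᗮ) :
    ε * ‖x‖ ^ 2 ≤ ∑ R, RCLike.re (inner ℂ x (S.term R x)) := by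
  have h := mul_norm_sq_le_re_inner_of_forall_hasEigenvalue S.isPositive_hamiltonian
    (fun t ht he => hε.2 ⟨ht, he⟩) hx
  rwa [hamiltonian_apply, inner_sum, map_sum] at h

theorem correlation_eq (Φ : Fock M) (O O' : FockOp M) : S.correlation Φ O O' =
    ‖inner ℂ Φ (O (O' Φ - S.groundSpace.starProjection (O' Φ)))‖ /
      (‖ContinuousLinearMap.adjoint O Φ‖ * ‖O' Φ‖) := rfl

open scoped Classical in
/-- Decay of correlations, for a family of projectors with the ground space as common kernel. -/
theorem correlation_le {P : Λ → FockOp M} (hP : ∀ R, IsStarProjection (P R))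
    (hK : commonKer P = S.groundSpace) {g c D : ℕ} (hg0 : 0 < g) (hg : interactionDegree P ≤ g)
    (hc : 2 ≤ c) (hcol : (interactionGraph P).Colorable c) {ε : ℝ} (hε : 0 < ε)
    (hgap : ∀ x ∈ S.groundSpaceᗮ, ε * ‖x‖ ^ 2 ≤ ∑ R, ‖P R x‖ ^ 2) {O O' : FockOp M}
    (hD : operatorDist P O O' = D) {Φ : Fock M} (hΦ : Φ ∈ S.groundSpace) :
    S.correlation Φ O O' ≤ 2 * Real.exp 1 ^ 2 *
      Real.exp (-(((D : ℝ) - 1) / ((c : ℝ) - 1) * √(ε / ((g : ℝ) ^ 2 + ε)))) := by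
  rw [correlation_eq]
  refine div_le_of_le_mul₀ (by positivity) (by positivity) ?_
  rw [← hK] at hgap hΦ ⊢
  exact norm_inner_sub_starProjection_le hP commute_of_not_adj_interactionGraph hg0
    (fun R => (degree_le_interactionDegree P R).trans hg) hc hcol hε hgap
    (le_operatorDist_iff.1 hD.ge) hΦ

theorem correlation_eq_zero {P : Λ → FockOp M} (hP : ∀ R, IsStarProjection (P R))
    (hK : commonKer P = S.groundSpace) {ε : ℝ} (hε : 0 < ε)
    (hgap : ∀ x ∈ S.groundSpaceᗮ, ε * ‖x‖ ^ 2 ≤ ∑ R, ‖P R x‖ ^ 2) {O O' : FockOp M}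
    (hD : operatorDist P O O' = ⊤) {Φ : Fock M} (hΦ : Φ ∈ S.groundSpace) :
    S.correlation Φ O O' = 0 := by
  rw [correlation_eq]
  rw [← hK] at hgap hΦ ⊢
  rw [inner_sub_starProjection_eq_zero hP commute_of_not_adj_interactionGraph hε hgap
    (fun R hR R' hR' => top_le_iff.1 (le_operatorDist_iff.1 hD.ge R hR R' hR')) hΦ]
  simp

end FrustrationFreeFermions

/-! ### The Gosset–Huang inequality and the gap bounds -/

open scoped Classical in
-- A graph without edges needs only one colour. Positivity of `g` is what makes `δ < 1` in the
-- Chebyshev estimate.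
theorem interactionDegree_pos {M : Type u} {Λ : Type v} [Fintype M] [Fintype Λ]
    {H : Λ → FockOp M} {c : ℕ} (hc : (interactionGraph H).chromaticNumber = c) (h2 : 2 ≤ c) :
    0 < interactionDegree H := by
  by_contra h0
  have h1 : (interactionGraph H).Colorable 1 :=
    SimpleGraph.colorable_of_degree_lt _ fun R =>
      lt_of_le_of_lt (degree_le_interactionDegree H R) (by omega)
  have h3 := h1.chromaticNumber_le
  rw [hc] at h3
  have : c ≤ 1 := by exact_mod_cast h3
  omega

theorem gosset_huang {M : Type u} {Λ : Type v} [Fintype M] [LinearOrder M] [Fintype Λ]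
    (S : FrustrationFreeFermions M Λ) (hS : ∀ R, IsStarProjection (S.term R)) (Φ : Fock M)
    (hΦ : S.IsGroundState Φ) (O O' : FockOp M) (ε : ℝ) (hε : S.IsGap ε) :
    (∀ D c : ℕ, operatorDist S.term O O' = D →
      (interactionGraph S.term).chromaticNumber = c → 2 ≤ c →
      S.correlation Φ O O' ≤ 2 * Real.exp 1 ^ 2 *
        Real.exp (-(((D : ℝ) - 1) / ((c : ℝ) - 1) *
          Real.sqrt (ε / ((interactionDegree S.term : ℝ) ^ 2 + ε))))) ∧
    (operatorDist S.term O O' = ⊤ → S.correlation Φ O O' = 0) := by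
  have hgap : ∀ x ∈ S.groundSpaceᗮ, ε * ‖x‖ ^ 2 ≤ ∑ R, ‖S.term R x‖ ^ 2 := by
    intro x hx
    refine (hε.mul_norm_sq_le hx).trans_eq (Finset.sum_congr rfl fun R _ => ?_)
    exact ((hS R).norm_sq_eq x).symm
  refine ⟨fun D c hD hc h2 => ?_, fun hD => ?_⟩
  · have hcol : (interactionGraph S.term).Colorable c :=
      SimpleGraph.chromaticNumber_le_iff_colorable.1 hc.le
    exact FrustrationFreeFermions.correlation_le hS S.groundSpace_eq_commonKer.symm
      (interactionDegree_pos hc h2) le_rfl h2 hcol hε.1.1 hgap hD hΦ.2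
  · exact FrustrationFreeFermions.correlation_eq_zero hS S.groundSpace_eq_commonKer.symm
      hε.1.1 hgap hD hΦ.2

open scoped Classical in
theorem gap_le_of_correlation (g : ℕ) (J a C Δ : ℝ) (ha : 0 < a) (hC : 0 < C) (hΔ : 0 < Δ) :
    ∃ C' > (0 : ℝ), ∃ L₀ > (1 : ℝ),
      ∀ (M : Type u) (Λ : Type v) [Fintype M] [LinearOrder M] [Fintype Λ]
        (S : FrustrationFreeFermions M Λ) (L : ℝ) (Φ : Fock M) (O O' : FockOp M) (D : ℕ) (ε : ℝ),
        L₀ ≤ L → interactionDegree S.termProj ≤ g → (∀ R, ‖S.term R‖ ≤ J) →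
        S.IsGroundState Φ → operatorDist S.termProj O O' = D → a * L ≤ D →
        C * L ^ (-Δ) ≤ S.correlation Φ O O' → S.IsGap ε →
        ε ≤ C' * Real.log L ^ 2 / L ^ 2 := by
  set B : ℝ := |Real.log (2 * Real.exp 1 ^ 2 / C)| + Δ with hB
  have hB0 : 0 < B := by positivity
  set K : ℝ := 2 * (g + 1) / a * B with hK
  have hK0 : 0 < K := by positivity
  -- Keeps the norm bound positive, since `J` is an arbitrary real.
  set J' : ℝ := max J 1 with hJ'
  have hJ0 : 0 < J' := lt_of_lt_of_le one_pos (le_max_right _ _)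
  -- `G` serves both as a positive degree bound and as `c - 1` for a colouring with `g + 2` colours.
  set G : ℝ := (g : ℝ) + 1 with hG
  have hG0 : 0 < G := by positivity
  have hlim : Tendsto (fun L : ℝ => K ^ 2 * (Real.log L ^ 2 / L ^ 2)) atTop (𝓝 0) := by
    have h := (Real.isLittleO_log_id_atTop.tendsto_div_nhds_zero).pow 2
    have h2 := h.const_mul (K ^ 2)
    simpa [div_pow] using h2
  obtain ⟨L₁, hL₁⟩ := eventually_atTop.1
    (hlim.eventually (ge_mem_nhds (show (0 : ℝ) < 1 / 2 by norm_num)))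
  -- `L ≥ e` gives `log L ≥ 1`, so constants are absorbed into `B log L`; `L ≥ 2 / a` gives `D - 1 ≥
  -- a L / 2`; `L ≥ L₁` gives `δ ≤ 1/2`.
  refine ⟨2 * G ^ 2 * K ^ 2 * J', by positivity, max L₁ (max (Real.exp 1) (2 / a)), ?_, ?_⟩
  · exact lt_of_lt_of_le (by simp) ((le_max_left _ _).trans (le_max_right _ _))
  intro M Λ _ _ _ S L Φ O O' D ε hL hg hJ hΦ hD haD hcorr hε
  have hLe : Real.exp 1 ≤ L := ((le_max_left _ _).trans (le_max_right _ _)).trans hL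
  have hLa : 2 / a ≤ L := ((le_max_right _ _).trans (le_max_right _ _)).trans hL
  have hL0 : 0 < L := (Real.exp_pos 1).trans_le hLe
  have hlog : 1 ≤ Real.log L := (Real.le_log_iff_exp_le hL0).2 hLe
  have hhalf : K ^ 2 * (Real.log L ^ 2 / L ^ 2) ≤ 1 / 2 := hL₁ L ((le_max_left _ _).trans hL)
  have hε0 : 0 < ε := hε.1.1
  set e : ℝ := ε / J' with he
  have he0 : 0 < e := by positivity
  have hgap : ∀ x ∈ S.groundSpaceᗮ, e * ‖x‖ ^ 2 ≤ ∑ R, ‖S.termProj R x‖ ^ 2 := by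
    intro x hx
    have h1 : ε * ‖x‖ ^ 2 ≤ J' * ∑ R, ‖S.termProj R x‖ ^ 2 := by
      rw [Finset.mul_sum]
      exact (hε.mul_norm_sq_le hx).trans (Finset.sum_le_sum fun R _ =>
        S.re_inner_term_le ((hJ R).trans (le_max_left _ _)) x)
    rw [he, div_mul_eq_mul_div, div_le_iff₀ hJ0]
    linarith
  have hcol : (interactionGraph S.termProj).Colorable (g + 2) :=
    SimpleGraph.colorable_of_degree_lt _ fun R =>
      ((degree_le_interactionDegree _ R).trans hg).trans_lt (by omega)
  have hmain := hcorr.trans (FrustrationFreeFermions.correlation_le S.isStarProjection_termProj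
    S.commonKer_termProj (Nat.succ_pos g) (hg.trans (Nat.le_succ g)) (by omega) hcol he0 hgap hD
    hΦ.2)
  push_cast at hmain
  rw [show (g : ℝ) + 2 - 1 = G by rw [hG]; ring] at hmain
  set s := √(e / (G ^ 2 + e)) with hs
  have hs0 : 0 ≤ s := Real.sqrt_nonneg _
  have hlogs := Real.log_le_log (by positivity) hmain
  rw [Real.log_mul hC.ne' (by positivity), Real.log_rpow hL0, Real.log_mul (by positivity)
    (by positivity), Real.log_exp] at hlogs
  have hdiv : Real.log (2 * Real.exp 1 ^ 2 / C) = Real.log (2 * Real.exp 1 ^ 2) - Real.log C :=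
    Real.log_div (by positivity) hC.ne'
  have hupper : ((D : ℝ) - 1) / G * s ≤ B * Real.log L := by
    have h1 := le_abs_self (Real.log (2 * Real.exp 1 ^ 2 / C))
    have h2 := mul_le_mul_of_nonneg_left hlog (abs_nonneg (Real.log (2 * Real.exp 1 ^ 2 / C)))
    rw [hB, add_mul]
    linarith
  have hlower : a * L / 2 / G * s ≤ ((D : ℝ) - 1) / G * s := by
    have : 2 ≤ a * L := by rwa [div_le_iff₀' ha] at hLa
    gcongr
    linarith
  have hsK : s ≤ K * (Real.log L / L) := by
    have h := hlower.trans hupper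
    have h2 : a * L / 2 / G * (K * (Real.log L / L)) = B * Real.log L := by
      rw [hK]; field_simp
    rw [← h2] at h
    exact le_of_mul_le_mul_left h (by positivity)
  have hδ : e / (G ^ 2 + e) ≤ K ^ 2 * (Real.log L ^ 2 / L ^ 2) := by
    have h := pow_le_pow_left₀ hs0 hsK 2
    rwa [hs, Real.sq_sqrt (by positivity), mul_pow, div_pow] at h
  -- From `δ = e / (G² + e) ≤ 1/2` follows `e ≤ G²`, and then `e = δ (G² + e) ≤ 2 G² δ`.
  have heG : e ≤ G ^ 2 := by
    have h := hδ.trans hhalf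
    rw [div_le_iff₀ (by positivity)] at h
    linarith
  have hfin : e ≤ 2 * G ^ 2 * (K ^ 2 * (Real.log L ^ 2 / L ^ 2)) := by
    have h : e = e / (G ^ 2 + e) * (G ^ 2 + e) := by field_simp
    rw [h, mul_comm (2 * G ^ 2)]
    exact mul_le_mul hδ (by linarith) (by positivity) (by positivity)
  calc ε = e * J' := by rw [he]; field_simp
    _ ≤ 2 * G ^ 2 * (K ^ 2 * (Real.log L ^ 2 / L ^ 2)) * J' := by gcongr
    _ = _ := by ring

/-- A bound valid along the tail of a sequence holds along the whole sequence, with a larger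
constant. -/
theorem exists_forall_le_of_eventually_le {ε b : ℕ → ℝ} (hb : ∀ n, 0 < b n) {C : ℝ} (hC : 0 < C)
    (h : ∀ᶠ n in atTop, ε n ≤ C * b n) : ∃ C' > (0 : ℝ), ∀ n, ε n ≤ C' * b n := by
  obtain ⟨N, hN⟩ := eventually_atTop.1 h
  have hnn : ∀ n ∈ Finset.range N, 0 ≤ |ε n| / b n := fun n _ =>
    div_nonneg (abs_nonneg _) (hb n).le
  have hs : 0 ≤ ∑ n ∈ Finset.range N, |ε n| / b n := Finset.sum_nonneg hnn
  refine ⟨C + ∑ n ∈ Finset.range N, |ε n| / b n, by positivity, fun n => ?_⟩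
  rcases le_or_gt N n with hn | hn
  · refine (hN n hn).trans (mul_le_mul_of_nonneg_right ?_ (hb n).le)
    linarith
  · have h1 := Finset.single_le_sum hnn (Finset.mem_range.2 hn)
    calc ε n ≤ |ε n| := le_abs_self _
      _ = |ε n| / b n * b n := (div_mul_cancel₀ _ (hb n).ne').symm
      _ ≤ _ := mul_le_mul_of_nonneg_right (by linarith) (hb n).le

end

theorem mainTheorem5 :
    -- The Gosset--Huang inequality for local terms that are orthogonal projectors.
    (∀ (M : Type u) (Λ : Type v) [Fintype M] [LinearOrder M] [Fintype Λ]
      (S : FrustrationFreeFermions M Λ), (∀ R, IsStarProjection (S.term R)) →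
      ∀ (Φ : Fock M), S.IsGroundState Φ → ∀ (O O' : FockOp M) (ε : ℝ), S.IsGap ε →
        (∀ D c : ℕ, operatorDist S.term O O' = D →
          (interactionGraph S.term).chromaticNumber = c → 2 ≤ c →
          S.correlation Φ O O' ≤ 2 * Real.exp 1 ^ 2 *
            Real.exp (-(((D : ℝ) - 1) / ((c : ℝ) - 1) *
              Real.sqrt (ε / ((interactionDegree S.term : ℝ) ^ 2 + ε))))) ∧
        (operatorDist S.term O O' = ⊤ → S.correlation Φ O O' = 0)) ∧
    -- The upper bound on the gap, with constants that depend only on the uniform data.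
    (∀ (g : ℕ) (J a C Δ : ℝ), 0 < a → 0 < C → 0 < Δ →
      ∃ C' > (0 : ℝ), ∃ L₀ > (1 : ℝ),
        ∀ (M : Type u) (Λ : Type v) [Fintype M] [LinearOrder M] [Fintype Λ]
          (S : FrustrationFreeFermions M Λ) (L : ℝ) (Φ : Fock M) (O O' : FockOp M) (D : ℕ) (ε : ℝ),
          L₀ ≤ L → interactionDegree S.termProj ≤ g → (∀ R, ‖S.term R‖ ≤ J) →
          S.IsGroundState Φ → operatorDist S.termProj O O' = D → a * L ≤ D →
          C * L ^ (-Δ) ≤ S.correlation Φ O O' → S.IsGap ε →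
          ε ≤ C' * Real.log L ^ 2 / L ^ 2) ∧
    -- The upper bound on the gap along a sequence of systems of growing linear size.
    (∀ (M : ℕ → Type u) (Λ : ℕ → Type v) [∀ n, Fintype (M n)] [∀ n, LinearOrder (M n)]
      [∀ n, Fintype (Λ n)] (S : ∀ n, FrustrationFreeFermions (M n) (Λ n)) (L : ℕ → ℝ)
      (Φ : ∀ n, Fock (M n)) (O O' : ∀ n, FockOp (M n)) (D : ℕ → ℕ) (ε : ℕ → ℝ)
      (g : ℕ) (J a C Δ : ℝ), 0 < a → 0 < C → 0 < Δ →
      (∀ n, 1 < L n) → Tendsto L atTop atTop →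
      (∀ n, interactionDegree (S n).termProj ≤ g) → (∀ n R, ‖(S n).term R‖ ≤ J) →
      (∀ n, (S n).IsGroundState (Φ n)) →
      (∀ n, operatorDist (S n).termProj (O n) (O' n) = D n) → (∀ n, a * L n ≤ D n) →
      (∀ n, C * L n ^ (-Δ) ≤ (S n).correlation (Φ n) (O n) (O' n)) →
      (∀ n, (S n).IsGap (ε n)) →
      ∃ C' > (0 : ℝ), ∀ n, ε n ≤ C' * Real.log (L n) ^ 2 / L n ^ 2) := by
  refine ⟨fun M Λ _ _ _ S hS Φ hΦ O O' ε hε => gosset_huang S hS Φ hΦ O O' ε hε,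
    fun g J a C Δ ha hC hΔ => gap_le_of_correlation g J a C Δ ha hC hΔ, ?_⟩
  intro M Λ _ _ _ S L Φ O O' D ε g J a C Δ ha hC hΔ hL1 hL hg hJ hΦ hD haD hcorr hε
  obtain ⟨C', hC', L₀, -, h⟩ := gap_le_of_correlation.{u, v} g J a C Δ ha hC hΔ
  have hb : ∀ n, 0 < Real.log (L n) ^ 2 / L n ^ 2 := fun n =>
    div_pos (pow_pos (Real.log_pos (hL1 n)) 2) (pow_pos (one_pos.trans (hL1 n)) 2)
  simp only [mul_div_assoc] at h ⊢
  refine exists_forall_le_of_eventually_le hb hC' ?_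
  filter_upwards [hL.eventually_ge_atTop L₀] with n hn
  exact h _ _ (S n) (L n) (Φ n) (O n) (O' n) (D n) (ε n) hn (hg n) (hJ n) (hΦ n) (hD n) (haD n)
    (hcorr n) (hε n)
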